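/- Let $n>1$ and let $D\subset\mathbb C^n$ be a domain with $C^2$-smooth boundary (that is, near each boundary point $D=\{\rho<0\}$ for a real $C^2$ function $\rho$ with $d\rho\neq0$). Let $\xi\in\partial D$, let $\nu_\xi$ be the unit outward normal at $\xi$, and let $T_\xi$ be the real tangent hyperplane to $\partial D$ at $\xi$. Write $(z,w)=\sum_j z_j\overline{w_j}$, let $\delta(z)$ and $p(z)$ be the Euclidean distances from $z$ to $\partial D$ and to $T_\xi$, and put $d(z)=\min\{\delta(z),p(z)\}$. For $\alpha>0$ the admissible domain with vertex $\xi$ and aperture $\alpha$ is $$\mathcal A_\alpha(\xi)=\{z\in D:\ \operatorname{Re}(z-\xi,\nu_\xi)<0,\ |(z-\xi,\nu_\xi)|<(1+\alpha)d(z),\ |z-\xi|^2<\alpha d(z)\}.$$ For $z$ near $\partial D$ let $\zeta(z)$ be the point of $\partial D$ closest to $z$. If $f$ is holomorphic near $z$ and $v$ is a unit vector, the spherical derivative of $f$ at $z$ in the direction $v$ is $|df_z(v)|/(1+|f(z)|^2)$; the normal direction at $z$ is $v=\nu_{\zeta(z)}$, and the complex tangential directions at $z$ are the unit vectors $v$ with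 $(v,\nu_{\zeta(z)})=0$. Let $L\in\overline{\mathbb C}=\mathbb C\cup\{\infty\}$ and let $f$ be a complex-valued function in $D$ such that 1. $\lim_{t\to0^+}f(\xi-t\nu_\xi)=L$; 2. for every $\alpha>0$, $f$ is holomorphic in $\mathcal A_\alpha(\xi)$ and omits the value $L$ there (no condition if $L=\infty$); 3. for every $\alpha>0$ there is a constant $K$ such that, for all $z\in\mathcal A_\alpha(\xi)$ sufficiently close to $\xi$, the spherical derivative of $f$ at $z$ is at most $K/d(z)$ in the normal direction and at most $K/\sqrt{d(z)}$ in every complex tangential direction. Then $f$ has the admissible limit $L$ at $\xi$: for every $\alpha>0$, $f(z)\to L$ as $z\to\xi$, $z\in\mathcal A_\alpha(\xi)$. -/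

import Mathlib

open Filter Topology

noncomputable section

namespace AdmissibleLimit

/-- `ρ` is a `C²` local defining function, on the open neighbourhood `U` of `p`, of the set `D`:
it has no critical point in `U`, and `D ∩ U` is the part of `U` on which `ρ` is negative (so that
`∂D ∩ U` is the zero set of `ρ` in `U` when `D` is open, and `D` lies locally on one side of it). -/
structure IsLocalDefiningFunction {n : ℕ} (D : Set (EuclideanSpace ℂ (Fin n)))
    (p : EuclideanSpace ℂ (Fin n)) (U : Set (EuclideanSpace ℂ (Fin n)))
    (ρ : EuclideanSpace ℂ (Fin n) → ℝ) : Prop where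
  isOpen : IsOpen U
  mem : p ∈ U
  contDiffOn : ContDiffOn ℝ 2 ρ U
  fderiv_ne_zero : ∀ z ∈ U, fderiv ℝ ρ z ≠ 0
  inter_eq : D ∩ U = {z ∈ U | ρ z < 0}

/-- `D` is a domain (a nonempty connected open set) of `ℂⁿ` with `C²`-smooth boundary. -/
structure IsC2Domain {n : ℕ} (D : Set (EuclideanSpace ℂ (Fin n))) : Prop where
  isOpen : IsOpen D
  isConnected : IsConnected D
  exists_defining : ∀ p ∈ frontier D, ∃ U ρ, IsLocalDefiningFunction D p U ρ

/-- `ν` is the unit outward normal vector to `∂D` at `p`: the real differential at `p` of a local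
defining function is a positive multiple of the real scalar product with `ν`. -/
def IsOutwardUnitNormal {n : ℕ} (D : Set (EuclideanSpace ℂ (Fin n)))
    (p ν : EuclideanSpace ℂ (Fin n)) : Prop :=
  ‖ν‖ = 1 ∧ ∃ U ρ, IsLocalDefiningFunction D p U ρ ∧
    ∃ c : ℝ, 0 < c ∧ ∀ v, fderiv ℝ ρ p v = c * (inner ℂ ν v).re

/-- The real tangent hyperplane through `ξ` with normal vector `ν`. -/
def tangentPlane {n : ℕ} (ξ ν : EuclideanSpace ℂ (Fin n)) : Set (EuclideanSpace ℂ (Fin n)) :=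
  {w | (inner ℂ ν (w - ξ)).re = 0}

/-- The smaller of the Euclidean distances from `z` to `∂D` and to the real tangent hyperplane
at `ξ`. -/
def boundaryDist {n : ℕ} (D : Set (EuclideanSpace ℂ (Fin n)))
    (ξ ν z : EuclideanSpace ℂ (Fin n)) : ℝ :=
  min (Metric.infDist z (frontier D)) (Metric.infDist z (tangentPlane ξ ν))

/-- The admissible approach domain with vertex `ξ` and aperture `α`, where `ν` is the unit outward
normal at `ξ`. It lies on the inner side of the tangent hyperplane at `ξ`.
Mathlib's `inner ℂ ν (z - ξ)` is the Hermitian product `∑ⱼ (zⱼ - ξⱼ) * conj νⱼ`. -/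
def admissibleDomain {n : ℕ} (D : Set (EuclideanSpace ℂ (Fin n)))
    (ξ ν : EuclideanSpace ℂ (Fin n)) (α : ℝ) : Set (EuclideanSpace ℂ (Fin n)) :=
  {z ∈ D | (inner ℂ ν (z - ξ)).re < 0 ∧
    ‖inner ℂ ν (z - ξ)‖ < (1 + α) * boundaryDist D ξ ν z ∧
    ‖z - ξ‖ ^ 2 < α * boundaryDist D ξ ν z}

/-- `f` has the limit `L` (possibly `∞`) along the normal `ν` at `ξ`. -/
def HasNormalLimit {n : ℕ} (f : EuclideanSpace ℂ (Fin n) → ℂ)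
    (ξ ν : EuclideanSpace ℂ (Fin n)) (L : OnePoint ℂ) : Prop :=
  Tendsto (fun t : ℝ => (f (ξ - (t : ℂ) • ν) : OnePoint ℂ)) (𝓝[>] 0) (𝓝 L)

/-- `f` has the admissible limit `L` (possibly `∞`) at `ξ`. -/
def HasAdmissibleLimit {n : ℕ} (D : Set (EuclideanSpace ℂ (Fin n)))
    (f : EuclideanSpace ℂ (Fin n) → ℂ) (ξ ν : EuclideanSpace ℂ (Fin n)) (L : OnePoint ℂ) : Prop :=
  ∀ α : ℝ, 0 < α →
    Tendsto (fun z => (f z : OnePoint ℂ)) (𝓝[admissibleDomain D ξ ν α] ξ) (𝓝 L)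

/-- The spherical derivative of `f` at `z` in the (unit) direction `v`. -/
def sphericalDeriv {n : ℕ} (f : EuclideanSpace ℂ (Fin n) → ℂ)
    (z v : EuclideanSpace ℂ (Fin n)) : ℝ :=
  ‖fderiv ℂ f z v‖ / (1 + ‖f z‖ ^ 2)

/-- `ζ` is a point of `∂D` closest to `z`. -/
def IsNearestBoundaryPoint {n : ℕ} (D : Set (EuclideanSpace ℂ (Fin n)))
    (z ζ : EuclideanSpace ℂ (Fin n)) : Prop :=
  ζ ∈ frontier D ∧ dist z ζ = Metric.infDist z (frontier D)

/-- At the point `z`, the spherical derivative of `f` in the complex normal direction is at most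
`A`, and in every complex tangential direction it is at most `B`; these directions are those of
`∂D` at the boundary point closest to `z` (which is unique for `z` near `∂D`). -/
def SphericalDerivBound {n : ℕ} (D : Set (EuclideanSpace ℂ (Fin n)))
    (f : EuclideanSpace ℂ (Fin n) → ℂ) (z : EuclideanSpace ℂ (Fin n)) (A B : ℝ) : Prop :=
  ∀ ζ η, IsNearestBoundaryPoint D z ζ → IsOutwardUnitNormal D ζ η →
    sphericalDeriv f z η ≤ A ∧
    ∀ τ, inner ℂ η τ = 0 → ‖τ‖ = 1 → sphericalDeriv f z τ ≤ B

end AdmissibleLimit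

end

namespace AdmissibleLimit

open Metric

/-! If `L = c` is finite, `1/(f - c)` is holomorphic on the admissible domains because `c` is
omitted there, and its spherical derivative is at most a constant times that of `f`
(`HasDerivativeGrowth.inv_sub`). So it is enough to propagate largeness from the normal, that is, to
treat `L = ∞`.

In one variable, suppose the spherical derivative is bounded and the function is large at a point.
Then it has modulus at least 1 on a disc of fixed radius, so the logarithm of its modulus is a
nonnegative harmonic function there. Harnack's inequality keeps the function large on a smaller
disc, and a chain of such discs covers `[0, 1]` (`exists_norm_ge_at_one`).

In `ℂⁿ`, the growth condition bounds the derivative along displacements of size `d` in the complex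
normal direction and `√d` in the complex tangential ones, uniformly in `d`
(`exists_uniform_derivative_bound`). In these units a point `z` of an admissible domain is a bounded
distance from the real normal. The path has two legs, each in a complex line: from the normal to `z
- m d ν`, deep enough to lie in a paraboloid inside `D` (`exists_norm_ge_of_normal`), then outwards
along `ν` to `z` (`exists_norm_ge_of_inward`). -/

/-! ### Propagation of largeness in one complex variable. -/

/-- A spherical derivative bound makes `1 / (1 + |g|²)` Lipschitz. -/
lemma abs_inv_one_add_normSq_sub_le {g : ℂ → ℂ} {c : ℂ} {R K : ℝ}
    (hg : DifferentiableOn ℂ g (ball c R))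
    (hK : ∀ z ∈ ball c R, ‖deriv g z‖ ≤ K * (1 + ‖g z‖ ^ 2)) {z : ℂ} (hz : z ∈ ball c R) :
    |(1 + ‖g z‖ ^ 2)⁻¹ - (1 + ‖g c‖ ^ 2)⁻¹| ≤ K * ‖z - c‖ := by
  have hc : c ∈ ball c R := mem_ball_self (dist_nonneg.trans_lt hz)
  have hd : ∀ x ∈ ball c R, HasFDerivWithinAt (fun z => (1 + ‖g z‖ ^ 2)⁻¹)
      (-((1 + ‖g x‖ ^ 2) ^ 2)⁻¹ • (2 • (innerSL ℝ (g x)).comp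
        ((ContinuousLinearMap.toSpanSingleton ℂ (deriv g x)).restrictScalars ℝ))) (ball c R) x := by
    intro x hx
    have h1 : HasFDerivAt g
        ((ContinuousLinearMap.toSpanSingleton ℂ (deriv g x)).restrictScalars ℝ) x :=
      ((hg.differentiableAt (isOpen_ball.mem_nhds hx)).hasDerivAt.hasFDerivAt).restrictScalars ℝ
    have h2 : HasFDerivAt (fun z => 1 + ‖g z‖ ^ 2) _ x := h1.norm_sq.const_add 1
    have h3 := (hasDerivAt_inv (x := 1 + ‖g x‖ ^ 2) (by positivity)).comp_hasFDerivAt x h2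
    exact h3.hasFDerivWithinAt
  have := (convex_ball c R).norm_image_sub_le_of_norm_hasFDerivWithin_le (C := K) hd ?_ hc hz
  · simpa using this
  · intro x hx
    refine ContinuousLinearMap.opNorm_le_bound _ ?_ fun v => ?_
    · have := (norm_nonneg _).trans (hK x hx)
      exact nonneg_of_mul_nonneg_left this (by positivity)
    · have h1 : |inner ℝ (g x) (v * deriv g x)| ≤ ‖g x‖ * (‖v‖ * ‖deriv g x‖) := by
        simpa using abs_real_inner_le_norm (g x) (v * deriv g x)
      -- The gradient has norm at most `2|g||g'| / (1 + |g|²)²`; this inequality cancels one factor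
      -- of the denominator and the hypothesis cancels the other.
      have h2 : 2 * ‖g x‖ ≤ 1 + ‖g x‖ ^ 2 := by nlinarith [sq_nonneg (‖g x‖ - 1)]
      have h3 := hK x hx
      have e : ‖(-((1 + ‖g x‖ ^ 2) ^ 2)⁻¹ • (2 • (innerSL ℝ (g x)).comp
        ((ContinuousLinearMap.toSpanSingleton ℂ (deriv g x)).restrictScalars ℝ))) v‖
          = ((1 + ‖g x‖ ^ 2) ^ 2)⁻¹ * (2 * |inner ℝ (g x) (v * deriv g x)|) := by
        change ‖-((1 + ‖g x‖ ^ 2) ^ 2)⁻¹ * (2 • inner ℝ (g x) (v * deriv g x))‖ = _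
        rw [norm_mul, norm_neg, norm_inv, Real.norm_of_nonneg (by positivity), nsmul_eq_mul, norm_mul]
        norm_num
      rw [e, inv_mul_le_iff₀ (by positivity)]
      calc 2 * |inner ℝ (g x) (v * deriv g x)| ≤ 2 * (‖g x‖ * (‖v‖ * ‖deriv g x‖)) := by gcongr
        _ = (2 * ‖g x‖) * (‖v‖ * ‖deriv g x‖) := by ring
        _ ≤ (1 + ‖g x‖ ^ 2) * (‖v‖ * (K * (1 + ‖g x‖ ^ 2))) := by gcongr
        _ = _ := by ring

/-- Harnack-type inequality for the logarithm of a holomorphic function of modulus at least one. -/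
lemma log_norm_le_three_mul {g : ℂ → ℂ} {c : ℂ} {r : ℝ}
    (hg : DifferentiableOn ℂ g (ball c r)) (h1 : ∀ z ∈ ball c r, 1 ≤ ‖g z‖)
    (hc1 : 1 < ‖g c‖) {z : ℂ} (hz : z ∈ ball c (r / 4)) :
    Real.log ‖g c‖ ≤ 3 * Real.log ‖g z‖ := by
  have hr : 0 < r := by have := dist_nonneg.trans_lt hz; linarith
  have hne : ∀ z ∈ ball c r, g z ≠ 0 := fun z hz h => by
    have := h1 z hz; rw [h, norm_zero] at this; linarith
  have hc : c ∈ ball c r := mem_ball_self hr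
  -- A primitive `q` of `g'/g` is a logarithm of `g` up to a constant, so `Re q` is `log |g|` up to
  -- a constant.
  obtain ⟨q, hq⟩ := ((hg.deriv isOpen_ball).div hg hne).isExactOn_ball
  have hconst : ∀ z ∈ ball c r, g z * Complex.exp (-q z) = g c * Complex.exp (-q c) := by
    intro z hz
    refine isOpen_ball.is_const_of_deriv_eq_zero (f := fun z => g z * Complex.exp (-q z))
      (convex_ball c r).isPreconnected ?_ ?_ hz hc
    · exact hg.mul (fun x hx => ((hq x hx).differentiableAt.neg.cexp).differentiableWithinAt)
    · intro x hx
      have := ((hg.differentiableAt (isOpen_ball.mem_nhds hx)).hasDerivAt.mul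
        (hq x hx).neg.cexp).deriv
      refine this.trans ?_
      have := hne x hx
      simp only [Pi.div_apply, Pi.zero_apply]
      field_simp
      simp
  have hre : ∀ z ∈ ball c r, (q z - q c).re = Real.log ‖g z‖ - Real.log ‖g c‖ := by
    intro z hz
    have h := congrArg (fun w => Real.log ‖w‖) (hconst z hz)
    simp only [norm_mul, Complex.norm_exp, Complex.neg_re] at h
    rw [Real.log_mul (by simpa using hne z hz) (Real.exp_pos _).ne', Real.log_exp,
      Real.log_mul (by simpa using hne c hc) (Real.exp_pos _).ne', Real.log_exp] at h
    rw [Complex.sub_re]; linarith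
  have hsub : ∀ w : ℂ, w ∈ ball 0 r → c + w ∈ ball c r := fun w hw => by simpa using hw
  have hzr : z ∈ ball c r := ball_subset_ball (by linarith) hz
  have hm : 0 < Real.log ‖g c‖ := Real.log_pos hc1
  have hzn : ‖z - c‖ < r / 4 := by simpa [dist_eq_norm] using hz
  -- Since `log |g| ≥ 0`, the real part of `q c - q (c + w)` is at most `log |g c|`. For `|w| < r/4`
  -- Borel–Carathéodory bounds its modulus by two thirds of `log |g c|`, which leaves a third for
  -- `log |g z|`.
  have key := Complex.borelCaratheodory_zero (f := fun w => q c - q (c + w)) (z := z - c) hm ?_ ?_ hr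
    (by simpa [dist_eq_norm] using hzr) (by simp)
  · have h2 : ‖q c - q z‖ ≤ 2 * Real.log ‖g c‖ / 3 := by
      refine (by simpa using key : ‖q c - q z‖ ≤ _).trans ?_
      rw [div_le_div_iff₀ (by linarith) (by norm_num)]
      nlinarith [norm_nonneg (z - c)]
    have h3 := (Complex.abs_re_le_norm _).trans h2
    have h4 := hre z hzr
    have h5 := (abs_le.1 h3).2
    rw [Complex.sub_re] at h4 h5
    linarith
  · intro w hw
    have := (hq (c + w) (hsub w hw)).differentiableAt
    have h6 : DifferentiableAt ℂ (fun w => q (c + w)) w :=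
      this.comp w (differentiableAt_id.const_add c)
    exact (h6.const_sub _).differentiableWithinAt
  · intro w hw
    have h4 := hre _ (hsub w hw)
    have h5 := Real.log_nonneg (h1 _ (hsub w hw))
    simp only [Set.mem_ofPred_eq]
    rw [Complex.sub_re] at h4 ⊢
    linarith

/-- A function with bounded spherical derivative which is large at a point is large near it. -/
lemma exists_radius_norm_ge {K R : ℝ} (hK0 : 0 ≤ K) (hR : 0 < R) :
    ∃ r > 0, ∀ M : ℝ, ∃ M' : ℝ, ∀ (g : ℂ → ℂ) (c : ℂ), DifferentiableOn ℂ g (ball c R) →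
      (∀ z ∈ ball c R, ‖deriv g z‖ ≤ K * (1 + ‖g z‖ ^ 2)) → M' ≤ ‖g c‖ →
      ∀ z ∈ ball c r, M ≤ ‖g z‖ := by
  -- On this radius `1/(1 + |g|²)` grows by at most `1/4`. It starts below `1/4` because `|g c| ≥
  -- 2`, so it stays below `1/2`, which means `|g| ≥ 1`. The cube in the threshold undoes the factor
  -- 3 of the Harnack inequality.
  set ρ := min R (1 / (4 * (K + 1))) with hρ
  have hρ0 : 0 < ρ := lt_min hR (by positivity)
  refine ⟨ρ / 4, by positivity, fun M => ⟨max 2 (max M 1 ^ 3), fun g c hg hK hM z hz => ?_⟩⟩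
  have hg2 : 2 ≤ ‖g c‖ := (le_max_left _ _).trans hM
  have hone : ∀ z ∈ ball c ρ, 1 ≤ ‖g z‖ := by
    intro z hz
    have hzR : z ∈ ball c R := ball_subset_ball (min_le_left _ _) hz
    have h1 := (abs_le.1 (abs_inv_one_add_normSq_sub_le hg hK hzR)).2
    have h2 : ‖z - c‖ ≤ 1 / (4 * (K + 1)) := by
      have : ‖z - c‖ < ρ := by simpa [dist_eq_norm] using hz
      exact this.le.trans (min_le_right _ _)
    have h3 : K * ‖z - c‖ ≤ 1 / 4 := by
      rw [le_div_iff₀ (by positivity)] at h2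
      nlinarith [norm_nonneg (z - c)]
    have h4 : (1 + ‖g c‖ ^ 2)⁻¹ ≤ 1 / 4 := by
      rw [one_div]; gcongr; nlinarith
    have h5 : (1 + ‖g z‖ ^ 2)⁻¹ ≤ 1 / 2 := by linarith
    rw [inv_le_comm₀ (by positivity) (by norm_num)] at h5
    norm_num at h5
    nlinarith [norm_nonneg (g z)]
  have h := log_norm_le_three_mul (hg.mono (ball_subset_ball (min_le_left _ _))) hone
    (by linarith) hz
  have hz1 : 1 ≤ ‖g z‖ := hone z (ball_subset_ball (by linarith) hz)
  have h6 : max M 1 ^ 3 ≤ ‖g z‖ ^ 3 := by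
    refine ((le_max_right _ _).trans hM).trans ?_
    rw [← Real.log_le_log_iff (by linarith) (by positivity), Real.log_pow]
    exact_mod_cast h
  exact (le_max_left _ _).trans (le_of_pow_le_pow_left₀ (by norm_num) (by linarith) h6)

/-- A function with bounded spherical derivative on a neighbourhood of `[0, 1]` which is large at
`0` is large at `1`. -/
lemma exists_norm_ge_at_one {K R : ℝ} (hK0 : 0 ≤ K) (hR : 0 < R) (M : ℝ) :
    ∃ M' : ℝ, ∀ g : ℂ → ℂ, (∀ s ∈ Set.Icc (0 : ℝ) 1, ∀ z ∈ ball (s : ℂ) R,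
      DifferentiableAt ℂ g z ∧ ‖deriv g z‖ ≤ K * (1 + ‖g z‖ ^ 2)) → M' ≤ ‖g 0‖ → M ≤ ‖g 1‖ := by
  obtain ⟨r, hr, hstep⟩ := exists_radius_norm_ge hK0 hR
  obtain ⟨N, hN⟩ := exists_nat_gt (1 / r)
  have hN0 : (0 : ℝ) < N := lt_trans (by positivity) hN
  -- `M` is quantified inside the induction because each disc raises the threshold required at the
  -- previous centre. The radius `r` does not depend on `M`, so `N` steps suffice.
  have key : ∀ k : ℕ, k ≤ N → ∀ M : ℝ, ∃ M' : ℝ, ∀ g : ℂ → ℂ, (∀ s ∈ Set.Icc (0 : ℝ) 1,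
      ∀ z ∈ ball (s : ℂ) R, DifferentiableAt ℂ g z ∧ ‖deriv g z‖ ≤ K * (1 + ‖g z‖ ^ 2)) →
      M' ≤ ‖g 0‖ → M ≤ ‖g ((k / N : ℝ) : ℂ)‖ := by
    intro k
    induction k with
    | zero => exact fun _ M => ⟨M, fun g _ h => by simpa using h⟩
    | succ k ih =>
      intro hk M
      obtain ⟨M₁, h₁⟩ := hstep M
      obtain ⟨M', h'⟩ := ih (by omega) M₁
      have hkN : (k : ℝ) + 1 ≤ N := by exact_mod_cast hk
      have hmem : (k / N : ℝ) ∈ Set.Icc (0 : ℝ) 1 :=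
        ⟨by positivity, by rw [div_le_one hN0]; linarith⟩
      refine ⟨M', fun g hg h0 => h₁ g _ (fun z hz => ?_) (fun z hz => (hg _ hmem z hz).2)
        (h' g hg h0) _ ?_⟩
      · exact (hg _ hmem z hz).1.differentiableWithinAt
      · rw [mem_ball, dist_eq_norm, ← Complex.ofReal_sub, Complex.norm_real]
        have : ((k + 1 : ℕ) / N - k / N : ℝ) = 1 / N := by push_cast; ring
        rw [this, Real.norm_eq_abs, abs_of_pos (by positivity)]
        rwa [one_div_lt hN0 hr]
  obtain ⟨M', h'⟩ := key N le_rfl M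
  exact ⟨M', fun g hg h0 => by simpa [hN0.ne'] using h' g hg h0⟩

/-! ### Local geometry of a `C²` boundary. -/

variable {n : ℕ}

/-- Every real functional on `ℂⁿ` is the real part of the product with a vector, which depends
isometrically on it. -/
lemma exists_isometric_gradient :
    ∃ G : (EuclideanSpace ℂ (Fin n) →L[ℝ] ℝ) → EuclideanSpace ℂ (Fin n),
      (∀ l v, (inner ℂ (G l) v).re = l v) ∧ ∀ l l', ‖G l - G l'‖ = ‖l - l'‖ := by
  refine ⟨fun l => (InnerProductSpace.toDual ℂ _).symm (StrongDual.extendRCLikeₗᵢ (𝕜 := ℂ) l),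
    fun l v => ?_, fun l l' => ?_⟩
  · rw [InnerProductSpace.toDual_symm_apply]
    exact StrongDual.re_extendRCLike_apply (𝕜 := ℂ) l v
  · rw [← map_sub, LinearIsometryEquiv.norm_map, ← map_sub, LinearIsometryEquiv.norm_map]

lemma eq_of_re_inner_eq {x y : EuclideanSpace ℂ (Fin n)}
    (h : ∀ v, (inner ℂ x v).re = (inner ℂ y v).re) : x = y := by
  have h1 := h (x - y)
  have h2 : (inner ℂ (x - y) (x - y)).re = 0 := by
    rw [inner_sub_left, Complex.sub_re]; linarith
  rw [← sub_eq_zero]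
  have h3 : ‖x - y‖ ^ 2 = 0 := by rw [← inner_self_eq_norm_sq (𝕜 := ℂ)]; exact h2
  simpa using h3

/-- With `η = G/‖G‖`, one has `c(η - ν) = (c - ‖G‖)η + (G - G₀)`, and both terms are at most `‖G -
G₀‖` in norm. -/
lemma norm_sub_inv_smul_le {G G₀ ν : EuclideanSpace ℂ (Fin n)} {c : ℝ} (hc : 0 < c)
    (hν : ‖ν‖ = 1) (hG : G ≠ 0) (hG₀ : G₀ = (c : ℂ) • ν) :
    ‖((‖G‖ : ℂ)⁻¹ • G) - ν‖ ≤ 2 / c * ‖G - G₀‖ := by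
  have hGn : (‖G‖ : ℂ) ≠ 0 := by simpa using hG
  have hG₀n : ‖G₀‖ = c := by simp [hG₀, norm_smul, hν, abs_of_pos hc]
  set η := (‖G‖ : ℂ)⁻¹ • G with hη
  have hη1 : ‖η‖ = 1 := by rw [hη, norm_smul]; simp [hG]
  have e1 : (‖G‖ : ℂ) • η = G := by rw [hη, smul_inv_smul₀ hGn]
  have e : (c : ℂ) • (η - ν) = ((c - ‖G‖ : ℝ) : ℂ) • η + (G - G₀) := by
    rw [Complex.ofReal_sub, sub_smul, e1, hG₀, smul_sub]; abel
  have h1 : c * ‖η - ν‖ ≤ 2 * ‖G - G₀‖ := by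
    calc c * ‖η - ν‖ = ‖(c : ℂ) • (η - ν)‖ := by simp [norm_smul, abs_of_pos hc]
      _ ≤ ‖((c - ‖G‖ : ℝ) : ℂ) • η‖ + ‖G - G₀‖ := e ▸ norm_add_le _ _
      _ = |‖G₀‖ - ‖G‖| + ‖G - G₀‖ := by rw [norm_smul, hη1, hG₀n, Complex.norm_real]; simp
      _ ≤ _ := by
        have := abs_norm_sub_norm_le G₀ G
        rw [norm_sub_rev] at this
        linarith
  rw [div_mul_eq_mul_div, le_div_iff₀ hc]
  linarith

/-- Local geometry of a `C²` boundary: the domain contains a paraboloid touching the boundary, is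
locally stable under translation along the inner normal, and has a Lipschitz outward normal. -/
lemma exists_local_geometry {D : Set (EuclideanSpace ℂ (Fin n))} {ξ ν : EuclideanSpace ℂ (Fin n)}
    (hξ : ξ ∈ frontier D) (hν : IsOutwardUnitNormal D ξ ν) :
    ∃ r > 0, ∃ C ≥ 0,
      (∀ z ∈ ball ξ r, C * ‖z - ξ‖ ^ 2 < -(inner ℂ ν (z - ξ)).re → z ∈ D) ∧
      (∀ z ∈ D ∩ ball ξ r, ∀ τ : ℝ, 0 ≤ τ → z - (τ : ℂ) • ν ∈ ball ξ r → z - (τ : ℂ) • ν ∈ D) ∧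
      (∀ ζ ∈ frontier D ∩ ball ξ r, ∃ η, IsOutwardUnitNormal D ζ η ∧ ‖η - ν‖ ≤ C * ‖ζ - ξ‖) := by
  obtain ⟨hν1, U, ρ, hU, c, hc, hcν⟩ := hν
  have hρ2 : ∀ z ∈ U, ContDiffAt ℝ 2 ρ z := fun z hz => hU.contDiffOn.contDiffAt (hU.isOpen.mem_nhds hz)
  have hdiff : ∀ z ∈ U, DifferentiableAt ℝ ρ z := fun z hz => (hρ2 z hz).differentiableAt (by norm_num)
  have hC1 : ContDiffAt ℝ 1 (fderiv ℝ ρ) ξ := (hρ2 ξ hU.mem).fderiv_right (by norm_num)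
  obtain ⟨K, t, ht, hLip⟩ := hC1.exists_lipschitzOnWith
  have hνν : (inner ℂ ν ν).re = 1 := by
    have := inner_self_eq_norm_sq (𝕜 := ℂ) ν
    rw [hν1] at this; simpa using this
  have hpos : ∀ᶠ z in 𝓝 ξ, 0 < fderiv ℝ ρ z ν := by
    have hcont : ContinuousAt (fun z => fderiv ℝ ρ z ν) ξ :=
      hC1.continuousAt.clm_apply continuousAt_const
    refine hcont.eventually (lt_mem_nhds ?_)
    change 0 < fderiv ℝ ρ ξ ν
    rw [hcν, hνν]; linarith
  obtain ⟨r, hr, hrsub⟩ := Metric.mem_nhds_iff.1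
    (inter_mem (inter_mem ht (hU.isOpen.mem_nhds hU.mem)) hpos)
  have hrt : ball ξ r ⊆ t := fun z hz => (hrsub hz).1.1
  have hrU : ball ξ r ⊆ U := fun z hz => (hrsub hz).1.2
  have hξr : ξ ∈ ball ξ r := mem_ball_self hr
  have hmemD : ∀ z ∈ U, z ∈ D ↔ ρ z < 0 := fun z hz => by
    have := Set.ext_iff.1 hU.inter_eq z
    simpa [hz] using this
  have hξ0 : ρ ξ ≤ 0 := by
    by_contra! h
    have h1 : ∀ᶠ z in 𝓝 ξ, 0 < ρ z ∧ z ∈ U :=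
      ((hdiff ξ hU.mem).continuousAt.eventually (lt_mem_nhds h)).and (hU.isOpen.mem_nhds hU.mem)
    obtain ⟨z, hzD, hz⟩ := (mem_closure_iff_frequently.1 hξ.1 |>.and_eventually h1).exists
    exact absurd ((hmemD z hz.2).1 hzD) (by linarith [hz.1])
  obtain ⟨G, hG, hGiso⟩ := exists_isometric_gradient (n := n)
  have hL : ∀ z ∈ ball ξ r, ‖fderiv ℝ ρ z - fderiv ℝ ρ ξ‖ ≤ K * ‖z - ξ‖ := fun z hz => by
    simpa [dist_eq_norm] using hLip.dist_le_mul z (hrt hz) ξ (hrt hξr)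
  -- Taylor's formula gives `ρ z ≤ c Re(z - ξ, ν) + K‖z - ξ‖²`, so `K/c` would do for the
  -- paraboloid; the factor 2 comes from normalising the gradient.
  refine ⟨r, hr, (2 / c * K : ℝ), by positivity, ?_, ?_, ?_⟩
  · intro z hz hlt
    have hzn : ‖z - ξ‖ < r := by simpa [dist_eq_norm] using hz
    rw [hmemD z (hrU hz)]
    have hsub : closedBall ξ ‖z - ξ‖ ⊆ ball ξ r := closedBall_subset_ball hzn
    have h1 := (convex_closedBall ξ ‖z - ξ‖).norm_image_sub_le_of_norm_fderiv_le' (𝕜 := ℝ) (f := ρ)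
      (φ := fderiv ℝ ρ ξ) (C := K * ‖z - ξ‖) (x := ξ) (y := z)
      (fun x hx => hdiff x (hrU (hsub hx)))
      (fun x hx => (hL x (hsub hx)).trans (by
        gcongr; simpa [dist_eq_norm] using hx)) (mem_closedBall_self (norm_nonneg _))
      (by simp [dist_eq_norm])
    rw [Real.norm_eq_abs] at h1
    have h2 := (abs_le.1 h1).2
    rw [hcν] at h2
    have h3 : c * (2 / c * K * ‖z - ξ‖ ^ 2) < c * -(inner ℂ ν (z - ξ)).re := by gcongr
    have h4 : c * (2 / c * K * ‖z - ξ‖ ^ 2) = 2 * (K * ‖z - ξ‖ * ‖z - ξ‖) := by field_simp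
    have h5 : 0 ≤ K * ‖z - ξ‖ * ‖z - ξ‖ := by positivity
    linarith
  · rintro z ⟨hzD, hz⟩ τ hτ hzτ
    rw [hmemD _ (hrU hz)] at hzD
    rw [hmemD _ (hrU hzτ)]
    refine lt_of_le_of_lt ?_ hzD
    obtain ⟨x, hx, hmv⟩ := domain_mvt (f := ρ) (f' := fderiv ℝ ρ) (s := ball ξ r)
      (x := z - (τ : ℂ) • ν) (y := z)
      (fun x hx => (hdiff x (hrU hx)).hasFDerivAt.hasFDerivWithinAt) (convex_ball ξ r) hzτ hz
    have hxr : x ∈ ball ξ r := (convex_ball ξ r).segment_subset hzτ hz hx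
    have : fderiv ℝ ρ x (z - (z - (τ : ℂ) • ν)) = τ * fderiv ℝ ρ x ν := by
      rw [sub_sub_cancel, Complex.coe_smul, map_smul, smul_eq_mul]
    rw [this] at hmv
    have : 0 ≤ τ * fderiv ℝ ρ x ν := mul_nonneg hτ (hrsub hxr).2.le
    linarith
  · rintro ζ ⟨hζ, hζr⟩
    have hne := hU.fderiv_ne_zero ζ (hrU hζr)
    set g := G (fderiv ℝ ρ ζ) with hg
    have hg0 : g ≠ 0 := by
      intro h0
      apply hne
      ext v
      rw [← hG, ← hg, h0]; simp
    have hG₀ : G (fderiv ℝ ρ ξ) = (c : ℂ) • ν := by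
      refine eq_of_re_inner_eq fun v => ?_
      rw [hG, hcν, inner_smul_left]; simp
    refine ⟨(‖g‖ : ℂ)⁻¹ • g, ⟨?_, U, ρ, ⟨hU.isOpen, hrU hζr, hU.contDiffOn, hU.fderiv_ne_zero,
      hU.inter_eq⟩, ‖g‖, norm_pos_iff.2 hg0, fun v => ?_⟩, ?_⟩
    · rw [norm_smul]; simp [hg0]
    · rw [← hG, ← hg, inner_smul_left]
      have : ‖g‖ ≠ 0 := by simpa using hg0
      rw [← Complex.ofReal_inv, Complex.conj_ofReal, Complex.re_ofReal_mul]
      field_simp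
    · refine (norm_sub_inv_smul_le hc hν1 hg0 hG₀).trans ?_
      rw [hg, hGiso, mul_assoc]
      gcongr
      exact hL ζ hζr

/-! ### The distance `d` and the admissible domains. -/

variable {D : Set (EuclideanSpace ℂ (Fin n))} {ξ ν z : EuclideanSpace ℂ (Fin n)}

lemma boundaryDist_le_norm (hξ : ξ ∈ frontier D) : boundaryDist D ξ ν z ≤ ‖z - ξ‖ :=
  (min_le_left _ _).trans (dist_eq_norm z ξ ▸ infDist_le_dist_of_mem hξ)

lemma re_inner_self_eq_one (hν : ‖ν‖ = 1) : (inner ℂ ν ν).re = 1 := by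
  have := inner_self_eq_norm_sq (𝕜 := ℂ) ν
  rw [hν] at this; simpa using this

lemma boundaryDist_le_neg_re (hν : ‖ν‖ = 1) (hz : (inner ℂ ν (z - ξ)).re ≤ 0) :
    boundaryDist D ξ ν z ≤ -(inner ℂ ν (z - ξ)).re := by
  set x := (inner ℂ ν (z - ξ)).re with hx
  have hmem : z - (x : ℂ) • ν ∈ tangentPlane ξ ν := by
    have e : z - (x : ℂ) • ν - ξ = (z - ξ) - (x : ℂ) • ν := by abel
    simp only [tangentPlane, Set.mem_ofPred_eq]
    rw [e, inner_sub_right, inner_smul_right, Complex.sub_re, Complex.re_ofReal_mul,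
      re_inner_self_eq_one hν, ← hx]
    ring
  refine (min_le_right _ _).trans ((infDist_le_dist_of_mem hmem).trans ?_)
  rw [dist_eq_norm, sub_sub_cancel, norm_smul, hν, Complex.norm_real, Real.norm_eq_abs,
    abs_of_nonpos hz, mul_one]

lemma le_boundaryDist (hD : IsOpen D) (hξ : ξ ∈ frontier D) (hν : ‖ν‖ = 1) {c : ℝ}
    (hball : ball z c ⊆ D) (hz : c ≤ -(inner ℂ ν (z - ξ)).re) : c ≤ boundaryDist D ξ ν z := by
  refine le_min ((le_infDist ⟨ξ, hξ⟩).2 fun y hy => ?_)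
    ((le_infDist ⟨ξ, by simp [tangentPlane]⟩).2 fun y hy => ?_)
  · by_contra! h
    have hyD : y ∈ D := hball (by rwa [mem_ball'])
    rw [hD.frontier_eq] at hy
    exact hy.2 hyD
  · have hy' : (inner ℂ ν (y - ξ)).re = 0 := hy
    have e : (inner ℂ ν (y - z)).re = -(inner ℂ ν (z - ξ)).re := by
      rw [show y - z = (y - ξ) - (z - ξ) by abel, inner_sub_right, Complex.sub_re, hy', zero_sub]
    rw [dist_comm, dist_eq_norm]
    calc c ≤ (inner ℂ ν (y - z)).re := e ▸ hz
      _ ≤ ‖inner ℂ ν (y - z)‖ := Complex.re_le_norm _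
      _ ≤ ‖ν‖ * ‖y - z‖ := norm_inner_le_norm _ _
      _ = ‖y - z‖ := by rw [hν, one_mul]

/-- The ball misses the frontier, so by connectedness it lies in `D` or outside its closure, and its
centre decides which. -/
lemma ball_boundaryDist_subset (hD : IsOpen D) (hz : z ∈ D) :
    ball z (boundaryDist D ξ ν z) ⊆ D := by
  rcases le_or_gt (boundaryDist D ξ ν z) 0 with h0 | h0
  · rw [ball_eq_empty.2 h0]; exact Set.empty_subset _
  have hsub : ball z (boundaryDist D ξ ν z) ⊆ D ∪ (closure D)ᶜ := by
    intro y hy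
    by_contra hy'
    simp only [Set.mem_union, Set.mem_compl_iff, not_or, not_not] at hy'
    have hyf : y ∈ frontier D := by rw [hD.frontier_eq]; exact ⟨hy'.2, hy'.1⟩
    exact absurd (mem_ball'.1 hy)
      (not_lt.2 ((min_le_left _ _).trans (infDist_le_dist_of_mem hyf)))
  refine ((convex_ball z _).isPreconnected.subset_or_subset hD isClosed_closure.isOpen_compl
    (Set.disjoint_compl_right_iff_subset.2 subset_closure) hsub).resolve_right fun h => ?_
  exact h (mem_ball_self h0) (subset_closure hz)

lemma continuous_boundaryDist : Continuous (boundaryDist D ξ ν) :=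
  (continuous_infDist_pt _).min (continuous_infDist_pt _)

lemma isOpen_admissibleDomain (hD : IsOpen D) (α : ℝ) : IsOpen (admissibleDomain D ξ ν α) := by
  have hc := continuous_boundaryDist (D := D) (ξ := ξ) (ν := ν)
  have hi : Continuous fun z : EuclideanSpace ℂ (Fin n) => inner ℂ ν (z - ξ) := by fun_prop
  refine hD.inter ?_
  refine (isOpen_lt (Complex.continuous_re.comp hi) continuous_const).inter
    ((isOpen_lt hi.norm (continuous_const.mul hc)).inter
      (isOpen_lt (by fun_prop) (continuous_const.mul hc)))

lemma boundaryDist_pos {α : ℝ} (hα : 0 < α) (hz : z ∈ admissibleDomain D ξ ν α) :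
    0 < boundaryDist D ξ ν z :=
  pos_of_mul_pos_right ((norm_nonneg _).trans_lt hz.2.2.1) (by linarith)

/-! ### Derivative bounds in the frame of the vertex. -/

/-- A bound for the derivative in an arbitrary direction from bounds in the direction of a unit
vector and in the orthogonal directions. -/
lemma norm_apply_le_of_orthogonal {f : EuclideanSpace ℂ (Fin n) → ℂ}
    {η v : EuclideanSpace ℂ (Fin n)} {A B : ℝ} (hη : ‖η‖ = 1) (hA : sphericalDeriv f z η ≤ A)
    (hB0 : 0 ≤ B) (hB : ∀ τ, inner ℂ η τ = 0 → ‖τ‖ = 1 → sphericalDeriv f z τ ≤ B) :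
    ‖fderiv ℂ f z v‖ ≤ (‖inner ℂ η v‖ * A + 2 * ‖v‖ * B) * (1 + ‖f z‖ ^ 2) := by
  have hpos : 0 < 1 + ‖f z‖ ^ 2 := by positivity
  have hA' : ‖fderiv ℂ f z η‖ ≤ A * (1 + ‖f z‖ ^ 2) := (div_le_iff₀ hpos).1 hA
  have hηη : inner ℂ η η = (1 : ℂ) := by rw [inner_self_eq_norm_sq_to_K, hη]; simp
  have hB' : ∀ u, inner ℂ η u = 0 → ‖fderiv ℂ f z u‖ ≤ ‖u‖ * B * (1 + ‖f z‖ ^ 2) := by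
    intro u hu
    rcases eq_or_ne u 0 with rfl | hu0
    · simp
    have hun : (‖u‖ : ℂ) ≠ 0 := by simpa using hu0
    have h := (div_le_iff₀ hpos).1 (hB ((‖u‖ : ℂ)⁻¹ • u) (by rw [inner_smul_right, hu, mul_zero])
      (by rw [norm_smul]; simp [hu0]))
    rw [map_smul, norm_smul, norm_inv, Complex.norm_real, norm_norm,
      inv_mul_le_iff₀ (norm_pos_iff.2 hu0)] at h
    linarith
  set s := inner ℂ η v with hs
  have hu : inner ℂ η (v - s • η) = 0 := by
    rw [inner_sub_right, inner_smul_right, hηη, mul_one, ← hs, sub_self]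
  have hsn : ‖s‖ ≤ ‖v‖ := by simpa [hη] using norm_inner_le_norm (𝕜 := ℂ) η v
  have hun : ‖v - s • η‖ ≤ 2 * ‖v‖ := by
    have := norm_sub_le v (s • η)
    rw [norm_smul, hη] at this
    linarith
  calc ‖fderiv ℂ f z v‖ = ‖s • fderiv ℂ f z η + fderiv ℂ f z (v - s • η)‖ := by
        rw [map_sub, map_smul]; congr 1; abel
    _ ≤ ‖s‖ * ‖fderiv ℂ f z η‖ + ‖fderiv ℂ f z (v - s • η)‖ := by
        rw [← norm_smul]; exact norm_add_le _ _
    _ ≤ ‖s‖ * (A * (1 + ‖f z‖ ^ 2)) + 2 * ‖v‖ * B * (1 + ‖f z‖ ^ 2) := by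
        have := hB' _ hu
        gcongr
        refine this.trans ?_
        gcongr
    _ = _ := by ring

/-- The growth condition in terms of the normal direction at the vertex. -/
lemma exists_derivative_bound {f : EuclideanSpace ℂ (Fin n) → ℂ}
    (hξ : ξ ∈ frontier D) (hν : IsOutwardUnitNormal D ξ ν) {β : ℝ} (hβ : 0 < β)
    (hgrowth : ∃ K : ℝ, ∀ᶠ z in 𝓝[admissibleDomain D ξ ν β] ξ, SphericalDerivBound D f z
      (K / boundaryDist D ξ ν z) (K / √(boundaryDist D ξ ν z))) :
    ∃ K ≥ 0, ∀ᶠ z in 𝓝[admissibleDomain D ξ ν β] ξ, ∀ (s : ℂ) (w : EuclideanSpace ℂ (Fin n)),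
      inner ℂ ν w = 0 → ‖fderiv ℂ f z (s • ν + w)‖ ≤
        K * (‖s‖ / boundaryDist D ξ ν z + ‖w‖ / √(boundaryDist D ξ ν z)) * (1 + ‖f z‖ ^ 2) := by
  obtain ⟨r, hr, C, hC, -, -, hnormal⟩ := exists_local_geometry hξ hν
  obtain ⟨K₀, hK₀⟩ := hgrowth
  refine ⟨(2 * C * √β + 3) * |K₀|, by positivity, ?_⟩
  have hnear : ∀ᶠ z in 𝓝[admissibleDomain D ξ ν β] ξ, z ∈ ball ξ (min 1 (r / 2)) :=
    mem_nhdsWithin_of_mem_nhds (ball_mem_nhds _ (by positivity))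
  filter_upwards [hK₀, hnear, self_mem_nhdsWithin] with z hbd hzr hzA s w hw
  have hd := boundaryDist_pos hβ hzA
  have hdle := boundaryDist_le_norm (ν := ν) (z := z) hξ
  have hzn : ‖z - ξ‖ < min 1 (r / 2) := by simpa [dist_eq_norm] using hzr
  have hz1 := hzn.trans_le (min_le_left _ _)
  have hz2 := hzn.trans_le (min_le_right _ _)
  obtain ⟨ζ, hζ, hζd⟩ := isClosed_frontier.exists_infDist_eq_dist ⟨ξ, hξ⟩ z
  have hζξ : ‖ζ - ξ‖ ≤ 2 * ‖z - ξ‖ := by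
    have h1 : dist z ζ ≤ dist z ξ := hζd ▸ infDist_le_dist_of_mem hξ
    have h2 := dist_triangle_left ζ ξ z
    rw [← dist_eq_norm, ← dist_eq_norm]
    linarith
  obtain ⟨η, hη, hην⟩ := hnormal ζ ⟨hζ, by rw [mem_ball, dist_eq_norm]; linarith⟩
  obtain ⟨hA, hB⟩ := hbd ζ η ⟨hζ, hζd.symm⟩ hη
  set d := boundaryDist D ξ ν z with hd_def
  have hsd : 0 < √d := Real.sqrt_pos.2 hd
  have hsq : √d * √d = d := Real.mul_self_sqrt hd.le
  have hsd1 : √d ≤ 1 := Real.sqrt_le_iff.2 ⟨zero_le_one, by linarith⟩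
  have hA' : sphericalDeriv f z η ≤ |K₀| / d := hA.trans (by gcongr; exact le_abs_self _)
  have key := fun v => norm_apply_le_of_orthogonal (v := v) hη.1 hA' (B := |K₀| / √d)
    (by positivity) (fun τ h1 h2 => (hB τ h1 h2).trans (by gcongr; exact le_abs_self _))
  -- This makes it harmless to replace the normal at `ζ` by `ν`: the two differ by `O(√d)`, so a
  -- vector `w` orthogonal to `ν` has a component `O(√d ‖w‖)` along `η`. Against the bound `K/d`
  -- this costs only `O(‖w‖/√d)`.
  have hzs : ‖z - ξ‖ ≤ √β * √d := by
    rw [← Real.sqrt_mul hβ.le]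
    exact Real.le_sqrt_of_sq_le hzA.2.2.2.le
  have hν' : ‖fderiv ℂ f z ν‖ ≤ 3 * |K₀| / d * (1 + ‖f z‖ ^ 2) := by
    refine (key ν).trans ?_
    gcongr
    have h1 : ‖inner ℂ η ν‖ ≤ 1 := by
      simpa [hη.1, hν.1] using norm_inner_le_norm (𝕜 := ℂ) η ν
    have h2 : |K₀| / √d ≤ |K₀| / d := by
      gcongr
      nlinarith
    have h3 : ‖inner ℂ η ν‖ * (|K₀| / d) ≤ 1 * (|K₀| / d) := by gcongr
    rw [hν.1, mul_div_assoc]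
    linarith
  have hw' : ‖fderiv ℂ f z w‖ ≤ (2 * C * √β + 2) * |K₀| * (‖w‖ / √d) * (1 + ‖f z‖ ^ 2) := by
    refine (key w).trans ?_
    gcongr
    have h1 : ‖inner ℂ η w‖ ≤ 2 * C * √β * √d * ‖w‖ := by
      have e : inner ℂ η w = inner ℂ (η - ν) w := by rw [inner_sub_left, hw, sub_zero]
      rw [e]
      refine (norm_inner_le_norm _ _).trans ?_
      gcongr
      calc ‖η - ν‖ ≤ C * ‖ζ - ξ‖ := hην
        _ ≤ C * (2 * (√β * √d)) := by gcongr; linarith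
        _ = _ := by ring
    calc ‖inner ℂ η w‖ * (|K₀| / d) + 2 * ‖w‖ * (|K₀| / √d)
        ≤ 2 * C * √β * √d * ‖w‖ * (|K₀| / d) + 2 * ‖w‖ * (|K₀| / √d) := by gcongr
      _ = _ := by
        nth_rewrite 2 [← hsq]
        field_simp
  calc ‖fderiv ℂ f z (s • ν + w)‖ ≤ ‖s‖ * ‖fderiv ℂ f z ν‖ + ‖fderiv ℂ f z w‖ := by
        rw [map_add, map_smul, ← norm_smul]; exact norm_add_le _ _
    _ ≤ ‖s‖ * (3 * |K₀| / d * (1 + ‖f z‖ ^ 2)) +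
        (2 * C * √β + 2) * |K₀| * (‖w‖ / √d) * (1 + ‖f z‖ ^ 2) := by gcongr
    _ = (3 * |K₀| * (‖s‖ / d) + (2 * C * √β + 2) * |K₀| * (‖w‖ / √d)) * (1 + ‖f z‖ ^ 2) := by ring
    _ ≤ ((2 * C * √β + 3) * |K₀| * (‖s‖ / d) + (2 * C * √β + 3) * |K₀| * (‖w‖ / √d))
        * (1 + ‖f z‖ ^ 2) := by
        have : 0 ≤ 2 * C * √β := by positivity
        gcongr <;> linarith
    _ = _ := by ring

/-! ### Propagation inside the admissible domains. -/

variable {h : EuclideanSpace ℂ (Fin n) → ℂ}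

lemma norm_inner_le_of_norm_eq_one (hν : ‖ν‖ = 1) (v : EuclideanSpace ℂ (Fin n)) :
    ‖inner ℂ ν v‖ ≤ ‖v‖ :=
  (norm_inner_le_norm ν v).trans (by rw [hν, one_mul])

/-- The ball and the real part put `q` at depth at least `d/2`, so bounds in units of `d` become
aperture bounds at the cost of a factor 2. The `+ 1` makes the quadratic inequality strict. -/
lemma mem_admissibleDomain_of_ball (hD : IsOpen D) (hξ : ξ ∈ frontier D) (hν : ‖ν‖ = 1)
    {q : EuclideanSpace ℂ (Fin n)} {d B S β : ℝ} (hd : 0 < d) (hball : ball q (d / 2) ⊆ D)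
    (hre : d / 2 ≤ -(inner ℂ ν (q - ξ)).re) (hB : ‖inner ℂ ν (q - ξ)‖ ≤ B * d)
    (hS : ‖q - ξ‖ ^ 2 ≤ S * d) (hβB : 2 * B ≤ β) (hβS : 2 * (S + 1) ≤ β) (hβ : 0 ≤ β) :
    q ∈ admissibleDomain D ξ ν β ∧ d / 2 ≤ boundaryDist D ξ ν q := by
  have h := le_boundaryDist hD hξ hν hball hre
  refine ⟨⟨hball (mem_ball_self (by positivity)), by linarith, ?_, ?_⟩, h⟩
  · have : (1 + β) * (d / 2) ≤ (1 + β) * boundaryDist D ξ ν q := by gcongr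
    nlinarith
  · have : β * (d / 2) ≤ β * boundaryDist D ξ ν q := by gcongr
    nlinarith

/-- Propagation of largeness along the complex line through `p` in the direction `v`. -/
lemma exists_norm_ge_add {K R : ℝ} (hK0 : 0 ≤ K) (hR : 0 < R) (M : ℝ) :
    ∃ M' : ℝ, ∀ (h : EuclideanSpace ℂ (Fin n) → ℂ) (p v : EuclideanSpace ℂ (Fin n)),
      (∀ s ∈ Set.Icc (0 : ℝ) 1, ∀ l ∈ ball (s : ℂ) R, DifferentiableAt ℂ h (p + l • v) ∧
        ‖fderiv ℂ h (p + l • v) v‖ ≤ K * (1 + ‖h (p + l • v)‖ ^ 2)) →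
      M' ≤ ‖h p‖ → M ≤ ‖h (p + v)‖ := by
  obtain ⟨M', hM'⟩ := exists_norm_ge_at_one hK0 hR M
  refine ⟨M', fun h p v hh hp => ?_⟩
  have := hM' (fun l => h (p + l • v)) (fun s hs l hl => ?_) (by simpa using hp)
  · simpa using this
  · obtain ⟨h1, h2⟩ := hh s hs l hl
    have h3 : HasDerivAt (fun l : ℂ => p + l • v) v l := by
      simpa using ((hasDerivAt_id l).smul_const v).const_add p
    have h4 : HasDerivAt (fun l : ℂ => h (p + l • v)) (fderiv ℂ h (p + l • v) v) l :=
      h1.hasFDerivAt.comp_hasDerivAt l h3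
    exact ⟨h4.differentiableAt, by rw [h4.deriv]; exact h2⟩

/-- Bounds for the spherical derivative, of the order of the inverse distance in the complex normal
direction at `ξ` and of its inverse square root in the tangential directions. -/
def HasDerivativeGrowth (D : Set (EuclideanSpace ℂ (Fin n))) (f : EuclideanSpace ℂ (Fin n) → ℂ)
    (ξ ν : EuclideanSpace ℂ (Fin n)) : Prop :=
  ∀ β : ℝ, 0 < β → ∃ K ≥ 0, ∀ᶠ z in 𝓝[admissibleDomain D ξ ν β] ξ,
    ∀ (s : ℂ) (w : EuclideanSpace ℂ (Fin n)), inner ℂ ν w = 0 → ‖fderiv ℂ f z (s • ν + w)‖ ≤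
      K * (‖s‖ / boundaryDist D ξ ν z + ‖w‖ / √(boundaryDist D ξ ν z)) * (1 + ‖f z‖ ^ 2)

/-- Here `d` is a reference scale, comparable from above with the depth of `q`. Displacements of
size `d` along `ν` and `√d` across it cancel the growth rates, so one constant and one aperture
serve all scales. -/
lemma exists_uniform_derivative_bound (hD : IsOpen D) (hξ : ξ ∈ frontier D) (hν : ‖ν‖ = 1)
    (hhol : ∀ α : ℝ, 0 < α → DifferentiableOn ℂ h (admissibleDomain D ξ ν α))
    (hgrowth : HasDerivativeGrowth D h ξ ν) {B S : ℝ} (hB : 0 < B) (hS : 0 < S) :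
    ∃ K ≥ 0, ∃ ε > 0, ∀ (d : ℝ) (q : EuclideanSpace ℂ (Fin n)), 0 < d → ball q (d / 2) ⊆ D →
      d / 2 ≤ -(inner ℂ ν (q - ξ)).re → ‖inner ℂ ν (q - ξ)‖ ≤ B * d → ‖q - ξ‖ ^ 2 ≤ S * d →
      ‖q - ξ‖ < ε → ∀ (a b : ℝ) (s : ℂ) (w : EuclideanSpace ℂ (Fin n)), 0 ≤ a → 0 ≤ b →
      inner ℂ ν w = 0 → ‖s‖ ≤ a * d → ‖w‖ ≤ b * √d →
      DifferentiableAt ℂ h q ∧ ‖fderiv ℂ h q (s • ν + w)‖ ≤ K * (2 * a + 2 * b) * (1 + ‖h q‖ ^ 2) := by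
  have hβ : 0 < 2 * (S + 1) + 2 * B := by positivity
  obtain ⟨K, hK0, hK⟩ := hgrowth _ hβ
  obtain ⟨ε, hε, hKε⟩ := Metric.mem_nhdsWithin_iff.1 hK
  refine ⟨K, hK0, ε, hε, fun d q hd h1 h2 h3 h4 hqε a b s w ha hb h5 h6 h7 => ?_⟩
  obtain ⟨hqA, hqd⟩ := mem_admissibleDomain_of_ball hD hξ hν hd h1 h2 h3 h4
    (by linarith : 2 * B ≤ 2 * (S + 1) + 2 * B) (by linarith) hβ.le
  refine ⟨(hhol _ hβ).differentiableAt ((isOpen_admissibleDomain hD _).mem_nhds hqA), ?_⟩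
  refine (hKε ⟨by rwa [mem_ball, dist_eq_norm], hqA⟩ s w h5).trans ?_
  set e := boundaryDist D ξ ν q with he
  have he0 : 0 < e := by linarith
  have hse : √d ≤ 2 * √e := by
    rw [Real.sqrt_le_iff]
    exact ⟨by positivity, by rw [mul_pow, Real.sq_sqrt he0.le]; linarith⟩
  have i1 : ‖s‖ / e ≤ 2 * a := by
    rw [div_le_iff₀ he0]
    have : a * d ≤ a * (2 * e) := by gcongr; linarith
    linarith
  have i2 : ‖w‖ / √e ≤ 2 * b := by
    rw [div_le_iff₀ (Real.sqrt_pos.2 he0)]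
    have : b * √d ≤ b * (2 * √e) := by gcongr
    linarith
  gcongr

lemma eventually_mul_norm_sub_lt (s : Set (EuclideanSpace ℂ (Fin n))) (A : ℝ) {c : ℝ} (hc : 0 < c) :
    ∀ᶠ z in 𝓝[s] ξ, A * ‖z - ξ‖ < c := by
  have h1 : Continuous fun z : EuclideanSpace ℂ (Fin n) => A * ‖z - ξ‖ := by fun_prop
  exact mem_nhdsWithin_of_mem_nhds (h1.continuousAt.eventually (gt_mem_nhds (by simpa using hc)))

lemma norm_le_two_of_mem_ball {s R : ℝ} {l : ℂ} (hs : s ∈ Set.Icc (0 : ℝ) 1) (hR : R ≤ 1)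
    (hl : l ∈ ball (s : ℂ) R) : ‖l‖ ≤ 2 := by
  rw [mem_ball, dist_eq_norm] at hl
  have := norm_le_norm_sub_add l s
  rw [Complex.norm_real, Real.norm_of_nonneg hs.1] at this
  linarith [hs.2]

/-- Propagation of largeness outwards along the normal direction. -/
lemma exists_norm_ge_of_inward (hD : IsOpen D) (hξ : ξ ∈ frontier D)
    (hν : IsOutwardUnitNormal D ξ ν)
    (hhol : ∀ α : ℝ, 0 < α → DifferentiableOn ℂ h (admissibleDomain D ξ ν α))
    (hgrowth : HasDerivativeGrowth D h ξ ν) {α m : ℝ} (hα : 0 < α) (hm : 1 ≤ m) (M : ℝ) :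
    ∃ M' : ℝ, ∀ᶠ z in 𝓝[admissibleDomain D ξ ν α] ξ,
      M' ≤ ‖h (z - ((m * boundaryDist D ξ ν z : ℝ) : ℂ) • ν)‖ → M ≤ ‖h z‖ := by
  have hm0 : 0 < m := by linarith
  obtain ⟨r, hr, C, -, -, htrans, -⟩ := exists_local_geometry hξ hν
  have hν1 := hν.1
  have hνν : inner ℂ ν ν = (1 : ℂ) := by rw [inner_self_eq_norm_sq_to_K, hν1]; simp
  obtain ⟨K, hK0, ε, hε, hK⟩ := exists_uniform_derivative_bound hD hξ hν1 hhol hgrowth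
    (B := 1 + α + 2 * m) (S := 2 * α + 1) (by positivity) (by positivity)
  -- With `R m = 1/2`, moving the parameter by less than `R` off `[0, 1]` displaces the point by at
  -- most `d/2`. A ball of radius `d/2` around it still fits in a translate of `ball z d`.
  obtain ⟨R, hR0, hR1, hRm⟩ : ∃ R : ℝ, 0 < R ∧ R ≤ 1 ∧ R * m = 1 / 2 :=
    ⟨1 / (2 * m), by positivity, by rw [div_le_one (by positivity)]; linarith, by field_simp⟩
  obtain ⟨M', hM'⟩ := exists_norm_ge_add (n := n) (K := K * (2 * m + 2 * 0)) (by positivity) hR0 M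
  refine ⟨M', ?_⟩
  filter_upwards [eventually_mul_norm_sub_lt _ (8 * m ^ 2) one_pos,
    eventually_mul_norm_sub_lt _ (1 + 2 * m) hε, eventually_mul_norm_sub_lt _ (m + 2) hr,
    self_mem_nhdsWithin] with z hs1 hs2 hs3 hzA hbig
  have hd := boundaryDist_pos hα hzA
  have hdn := boundaryDist_le_norm (ν := ν) (z := z) hξ
  have hdx := boundaryDist_le_neg_re (D := D) hν1 hzA.2.1.le
  have hballz := ball_boundaryDist_subset (ξ := ξ) (ν := ν) hD hzA.1
  obtain ⟨hzD, hzre, hza, hzsq⟩ := hzA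
  set d := boundaryDist D ξ ν z with hd_def
  set a := inner ℂ ν (z - ξ) with ha
  clear_value d a
  have hmd0 : 0 < m * d := by positivity
  have hmd : m * d ≤ m * ‖z - ξ‖ := by gcongr
  rw [show z = (z - ((m * d : ℝ) : ℂ) • ν) + (((m * d : ℝ) : ℂ) • ν + 0) by abel]
  refine hM' h _ _ (fun s hs l hl => ?_) hbig
  have hls : ‖l - s‖ < R := by rwa [mem_ball, dist_eq_norm] at hl
  set q := (z - ((m * d : ℝ) : ℂ) • ν) + l • (((m * d : ℝ) : ℂ) • ν + 0) with hq
  have hqz : q = z - (((1 - s) * (m * d) : ℝ) : ℂ) • ν + ((l - s) * ((m * d : ℝ) : ℂ)) • ν := by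
    rw [hq]; push_cast; module
  have hqξ : q - ξ = (z - ξ) + ((l - 1) * ((m * d : ℝ) : ℂ)) • ν := by
    rw [hq]; push_cast; module
  clear_value q
  have hin : inner ℂ ν (q - ξ) = a + (l - 1) * ((m * d : ℝ) : ℂ) := by
    rw [hqξ, inner_add_right, inner_smul_right, hνν, mul_one, ha]
  have hlsmd : ‖(l - s) * ((m * d : ℝ) : ℂ)‖ ≤ d / 2 := by
    rw [norm_mul, Complex.norm_real, Real.norm_of_nonneg hmd0.le]
    have : ‖l - s‖ * (m * d) ≤ R * (m * d) := by gcongr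
    rw [← mul_assoc R, hRm] at this
    linarith
  have hl1 : ‖(l - 1) * ((m * d : ℝ) : ℂ)‖ ≤ 2 * (m * d) := by
    rw [norm_mul, Complex.norm_real, Real.norm_of_nonneg hmd0.le]
    gcongr
    have h1 := norm_add_le (l - s) ((s : ℂ) - 1)
    rw [sub_add_sub_cancel] at h1
    have h2 : ‖(s : ℂ) - 1‖ ≤ 1 := by
      rw [← Complex.ofReal_one, ← Complex.ofReal_sub, Complex.norm_real, Real.norm_eq_abs, abs_le]
      constructor <;> linarith [hs.1, hs.2]
    linarith
  have hqn : ‖q - ξ‖ ≤ ‖z - ξ‖ + 2 * (m * d) := by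
    rw [hqξ]
    refine (norm_add_le _ _).trans ?_
    rw [norm_smul, hν1, mul_one]
    gcongr
  have hτ : 0 ≤ (1 - s) * (m * d) := mul_nonneg (by linarith [hs.2]) hmd0.le
  refine hK d q hd (fun y hy => ?_) ?_ ?_ ?_ (by linarith) m 0 _ 0 (by positivity) le_rfl (by simp)
    (Complex.norm_real _ ▸ (Real.norm_of_nonneg hmd0.le).le) (by simp)
  -- Translated back outwards, `y` lands in `ball z d ⊆ D`; stability of `D` under inward
  -- translation then returns it to `D`.
  · set y' := y + (((1 - s) * (m * d) : ℝ) : ℂ) • ν with hy'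
    have hτ1 : (1 - s) * (m * d) ≤ 1 * (m * d) := by
      gcongr
      linarith [hs.1]
    have hy'z : ‖y' - z‖ < d := by
      have e1 : y' - z = (y - q) + ((l - s) * ((m * d : ℝ) : ℂ)) • ν := by
        rw [hy', hqz]; abel
      rw [e1]
      refine (norm_add_le _ _).trans_lt ?_
      rw [norm_smul, hν1, mul_one]
      rw [mem_ball, dist_eq_norm] at hy
      linarith
    have hy'ξ : ‖y' - ξ‖ < ‖z - ξ‖ + d := by
      have := norm_add_le (y' - z) (z - ξ)
      rw [sub_add_sub_cancel] at this
      linarith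
    have hyy : y = y' - (((1 - s) * (m * d) : ℝ) : ℂ) • ν := by rw [hy']; abel
    have hyξ : ‖y - ξ‖ < r := by
      have := norm_sub_le (y' - ξ) ((((1 - s) * (m * d) : ℝ) : ℂ) • ν)
      rw [sub_right_comm, ← hyy, norm_smul, hν1, mul_one, Complex.norm_real,
        Real.norm_of_nonneg hτ] at this
      linarith
    rw [hyy]
    refine htrans y' ⟨hballz (by rwa [mem_ball, dist_eq_norm]), ?_⟩ _ hτ ?_
    · rw [mem_ball, dist_eq_norm]; linarith
    · rw [← hyy, mem_ball, dist_eq_norm]; exact hyξ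
  · have h1 : ((l - 1) * ((m * d : ℝ) : ℂ)).re = ((l - s) * ((m * d : ℝ) : ℂ)).re
        - (1 - s) * (m * d) := by
      rw [Complex.re_mul_ofReal, Complex.re_mul_ofReal]
      simp; ring
    have h2 := (Complex.re_le_norm _).trans hlsmd
    rw [hin, Complex.add_re, h1]
    linarith
  · rw [hin]
    refine (norm_add_le _ _).trans ?_
    linarith
  · have h2 : ‖q - ξ‖ ^ 2 ≤ (‖z - ξ‖ + 2 * (m * d)) ^ 2 := by gcongr
    have h3 : 8 * m ^ 2 * d * d ≤ 1 * d := by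
      gcongr
      have : 8 * m ^ 2 * d ≤ 8 * m ^ 2 * ‖z - ξ‖ := by gcongr
      linarith
    have h4 := sq_nonneg (‖z - ξ‖ - 2 * (m * d))
    linarith

/-- Propagation of largeness from the normal to points well inside the domain. -/
lemma exists_norm_ge_of_normal (hD : IsOpen D) (hξ : ξ ∈ frontier D)
    (hν : IsOutwardUnitNormal D ξ ν)
    (hhol : ∀ α : ℝ, 0 < α → DifferentiableOn ℂ h (admissibleDomain D ξ ν α))
    (hgrowth : HasDerivativeGrowth D h ξ ν) {α : ℝ} (hα : 0 < α) :
    ∃ m ≥ 1, ∀ M : ℝ, ∃ M' : ℝ, ∀ᶠ z in 𝓝[admissibleDomain D ξ ν α] ξ,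
      M' ≤ ‖h (ξ - ((-(inner ℂ ν (z - ξ)).re + m * boundaryDist D ξ ν z : ℝ) : ℂ) • ν)‖ →
      M ≤ ‖h (z - ((m * boundaryDist D ξ ν z : ℝ) : ℂ) • ν)‖ := by
  obtain ⟨r, hr, C, hC, hpar, -, -⟩ := exists_local_geometry hξ hν
  have hν1 := hν.1
  have hνν : inner ℂ ν ν = (1 : ℂ) := by rw [inner_self_eq_norm_sq_to_K, hν1]; simp
  -- The three terms of `m` pay for the paraboloid, for the shift of the real part caused by complex
  -- parameters with `|l| ≤ 2`, and for the ball of radius `d/2`. The value `32 α + 1` bounds `((B +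
  -- 1)d + 2‖w‖)²` in units of `d`, as `‖w‖² ≤ 4 α d` and `2(B + 1)² d ≤ 1` near `ξ`.
  obtain ⟨m, hm⟩ : ∃ m : ℝ, m = C * (32 * α + 1) + 2 * (1 + α) + 2 := ⟨_, rfl⟩
  have hm1 : 1 ≤ m := by
    have : 0 ≤ C * (32 * α + 1) := by positivity
    linarith
  obtain ⟨B, hB⟩ : ∃ B : ℝ, B = m + 3 * (1 + α) := ⟨_, rfl⟩
  have hB0 : 0 < B := by linarith
  obtain ⟨K, hK0, ε, hε, hK⟩ := exists_uniform_derivative_bound hD hξ hν1 hhol hgrowth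
    (B := B) (S := 32 * α + 1) hB0 (by positivity)
  refine ⟨m, hm1, fun M => ?_⟩
  obtain ⟨M', hM'⟩ := exists_norm_ge_add (n := n) (K := K * (2 * (1 + α) + 2 * (2 * √α)))
    (by positivity) one_pos M
  refine ⟨M', ?_⟩
  filter_upwards [eventually_mul_norm_sub_lt _ (2 * (B + 1) ^ 2) one_pos,
    eventually_mul_norm_sub_lt _ (B + 5) hε, eventually_mul_norm_sub_lt _ (B + 5) hr,
    self_mem_nhdsWithin] with z hs1 hs2 hs3 hzA hbig
  have hd := boundaryDist_pos hα hzA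
  have hdn := boundaryDist_le_norm (ν := ν) (z := z) hξ
  have hdx := boundaryDist_le_neg_re (D := D) hν1 hzA.2.1.le
  obtain ⟨hzD, hzre, hza, hzsq⟩ := hzA
  set d := boundaryDist D ξ ν z with hd_def
  set a := inner ℂ ν (z - ξ) with ha
  clear_value d
  obtain ⟨w, hw⟩ : ∃ w, w = z - ξ - a • ν := ⟨_, rfl⟩
  have han : ‖a‖ ≤ ‖z - ξ‖ := norm_inner_le_of_norm_eq_one hν1 _
  have hνw : inner ℂ ν w = 0 := by
    rw [hw, inner_sub_right, inner_smul_right, hνν, mul_one, ← ha, sub_self]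
  have hwn : ‖w‖ ≤ 2 * ‖z - ξ‖ := by
    have := norm_sub_le (z - ξ) (a • ν)
    rw [norm_smul, hν1, ← hw] at this
    linarith
  clear_value a
  have hare := (abs_le.1 (Complex.abs_re_le_norm a)).1
  have haim := Complex.abs_im_le_norm a
  have hdd : 2 * (B + 1) ^ 2 * d * d ≤ 1 * d := by
    gcongr
    have : 2 * (B + 1) ^ 2 * d ≤ 2 * (B + 1) ^ 2 * ‖z - ξ‖ := by gcongr
    linarith
  have hwsq : ‖w‖ ^ 2 ≤ 4 * (α * d) := by
    have : ‖w‖ ^ 2 ≤ (2 * ‖z - ξ‖) ^ 2 := by gcongr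
    linarith
  have hwsd : ‖w‖ ≤ 2 * √α * √d := by
    rw [mul_assoc, ← Real.sqrt_mul hα.le]
    refine le_of_sq_le_sq ?_ (by positivity)
    rw [mul_pow, Real.sq_sqrt (by positivity)]
    linarith
  have hmd0 : 0 < m * d := by positivity
  have hBd : B * d ≤ B * ‖z - ξ‖ := by gcongr
  have hBd' : B * d = m * d + 3 * ((1 + α) * d) := by rw [hB]; ring
  have hmd : m * d = C * ((32 * α + 1) * d) + 2 * ((1 + α) * d) + 2 * d := by rw [hm]; ring
  have hCd : 0 ≤ C * ((32 * α + 1) * d) := by positivity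
  obtain ⟨t, ht⟩ : ∃ t, t = -a.re + m * d := ⟨_, rfl⟩
  rw [← ht] at hbig
  -- The real part of `a` is absorbed in `t`, so the remaining displacement from the normal is `i Im
  -- a` along `ν`, of size `O(d)`, and the tangential `w`, of size `O(√d)`.
  have e : z - ((m * d : ℝ) : ℂ) • ν
      = (ξ - (t : ℂ) • ν) + ((Complex.I * a.im) • ν + w) := by
    have e2 : a = (a.re : ℂ) + Complex.I * a.im := by
      rw [mul_comm]; exact (Complex.re_add_im a).symm
    have e3 : a • ν = ((a.re : ℂ) + Complex.I * a.im) • ν := by rw [← e2]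
    rw [hw, e3, ht]
    push_cast
    module
  rw [e]
  refine hM' h _ _ (fun s hs l hl => ?_) hbig
  have hl2 := norm_le_two_of_mem_ball hs le_rfl hl
  set q := (ξ - (t : ℂ) • ν) + l • ((Complex.I * a.im) • ν + w) with hq
  have hqξ : q - ξ = (-(t : ℂ) + l * (Complex.I * a.im)) • ν + l • w := by
    rw [hq]; module
  clear_value q
  have hin : inner ℂ ν (q - ξ) = -(t : ℂ) + l * (Complex.I * a.im) := by
    rw [hqξ, inner_add_right, inner_smul_right, inner_smul_right, hνν, hνw]; ring
  have hli : |l.im * a.im| ≤ 2 * ((1 + α) * d) := by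
    rw [abs_mul]
    have := (Complex.abs_im_le_norm l).trans hl2
    gcongr
    linarith
  have hli' := (abs_le.1 hli).1
  have hinre : (inner ℂ ν (q - ξ)).re = -t - l.im * a.im := by
    rw [hin]; simp; ring
  have hinn : ‖inner ℂ ν (q - ξ)‖ ≤ B * d := by
    rw [hin]
    have h1 : ‖l * (Complex.I * a.im)‖ ≤ 2 * ((1 + α) * d) := by
      rw [norm_mul, norm_mul, Complex.norm_I, one_mul, Complex.norm_real, Real.norm_eq_abs]
      gcongr
      linarith
    have h2 : ‖-(t : ℂ)‖ ≤ (1 + α) * d + m * d := by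
      rw [norm_neg, Complex.norm_real, Real.norm_of_nonneg (by linarith)]
      linarith
    refine (norm_add_le _ _).trans ?_
    linarith
  have hqn : ‖q - ξ‖ ≤ B * d + 2 * ‖w‖ := by
    rw [← hin] at hqξ
    rw [hqξ]
    refine (norm_add_le _ _).trans ?_
    rw [norm_smul, norm_smul, hν1, mul_one]
    gcongr
  have hsq : ∀ x : ℝ, 0 ≤ x → x ≤ (B + 1) * d + 2 * ‖w‖ → x ^ 2 ≤ (32 * α + 1) * d := by
    intro x hx hx'
    have : x ^ 2 ≤ ((B + 1) * d + 2 * ‖w‖) ^ 2 := by gcongr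
    have h2 : 0 ≤ ((B + 1) * d - 2 * ‖w‖) ^ 2 := sq_nonneg _
    linarith
  refine hK d q hd (fun y hy => ?_) ?_ hinn (hsq _ (norm_nonneg _) (by linarith)) (by linarith)
    _ _ _ _ (by positivity) (by positivity) hνw ?_ hwsd
  · rw [mem_ball, dist_eq_norm] at hy
    have hyq := norm_add_le (y - q) (q - ξ)
    rw [sub_add_sub_cancel] at hyq
    have hyn : ‖y - ξ‖ ^ 2 ≤ (32 * α + 1) * d := hsq _ (norm_nonneg _) (by linarith)
    refine hpar y (by rw [mem_ball, dist_eq_norm]; linarith) ?_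
    have h1 : (inner ℂ ν (y - ξ)).re = (inner ℂ ν (y - q)).re + (inner ℂ ν (q - ξ)).re := by
      rw [← Complex.add_re, ← inner_add_right, sub_add_sub_cancel]
    have h2 : (inner ℂ ν (y - q)).re ≤ ‖y - q‖ :=
      (Complex.re_le_norm _).trans (norm_inner_le_of_norm_eq_one hν1 _)
    have h3 : C * ‖y - ξ‖ ^ 2 ≤ C * ((32 * α + 1) * d) := by gcongr
    rw [h1, hinre]
    linarith
  · rw [hinre]
    linarith
  · rw [norm_mul, Complex.norm_I, one_mul, Complex.norm_real, Real.norm_eq_abs]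
    linarith

/-- A function of the given growth tending to infinity along the normal tends to infinity in the
admissible domains. -/
theorem tendsto_norm_atTop_of_normal (hD : IsOpen D) (hξ : ξ ∈ frontier D)
    (hν : IsOutwardUnitNormal D ξ ν)
    (hhol : ∀ α : ℝ, 0 < α → DifferentiableOn ℂ h (admissibleDomain D ξ ν α))
    (hgrowth : HasDerivativeGrowth D h ξ ν)
    (hlim : Tendsto (fun t : ℝ => ‖h (ξ - (t : ℂ) • ν)‖) (𝓝[>] 0) atTop) {α : ℝ} (hα : 0 < α) :
    Tendsto (fun z => ‖h z‖) (𝓝[admissibleDomain D ξ ν α] ξ) atTop := by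
  obtain ⟨m, hm, hdeep⟩ := exists_norm_ge_of_normal hD hξ hν hhol hgrowth hα
  rw [Filter.tendsto_atTop]
  intro M
  -- Thresholds are chosen backwards along the path. This requires the depth factor `m` to be fixed
  -- before any of them.
  obtain ⟨M₁, h₁⟩ := exists_norm_ge_of_inward hD hξ hν hhol hgrowth hα hm M
  obtain ⟨M₂, h₂⟩ := hdeep M₁
  obtain ⟨u, hu, hlimu⟩ :=
    (mem_nhdsGT_iff_exists_Ioo_subset).1 (Filter.tendsto_atTop.1 hlim M₂)
  filter_upwards [h₁, h₂, eventually_mul_norm_sub_lt _ (1 + m) hu, self_mem_nhdsWithin]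
    with z hz₁ hz₂ hzu hzA
  refine hz₁ (hz₂ (hlimu ⟨?_, ?_⟩))
  · have := mul_pos (by linarith : 0 < m) (boundaryDist_pos hα hzA)
    have := hzA.2.1
    change 0 < -(inner ℂ ν (z - ξ)).re + m * boundaryDist D ξ ν z
    linarith
  · have h3 : ‖inner ℂ ν (z - ξ)‖ ≤ ‖z - ξ‖ :=
      norm_inner_le_of_norm_eq_one hν.1 _
    have h4 := (abs_le.1 (Complex.abs_re_le_norm (inner ℂ ν (z - ξ)))).1
    have h5 : m * boundaryDist D ξ ν z ≤ m * ‖z - ξ‖ := by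
      gcongr
      exact boundaryDist_le_norm hξ
    change -(inner ℂ ν (z - ξ)).re + m * boundaryDist D ξ ν z < u
    linarith

/-! ### Reduction of a finite limit to an infinite one. -/

/-- The omitted-value condition holds only in admissible domains; this makes it available along the
normal, where `f - c` has to be inverted. The aperture 4 is `2(S + 1)` with `S = 1`. -/
lemma eventually_normal_mem_admissibleDomain (hD : IsOpen D) (hξ : ξ ∈ frontier D)
    (hν : IsOutwardUnitNormal D ξ ν) :
    ∀ᶠ t : ℝ in 𝓝[>] 0, ξ - (t : ℂ) • ν ∈ admissibleDomain D ξ ν 4 := by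
  obtain ⟨r, hr, C, hC, hpar, -, -⟩ := exists_local_geometry hξ hν
  have hsmall : ∀ᶠ t : ℝ in 𝓝[>] 0, t < min 1 (min (r / 2) (1 / (9 * (C + 1)))) :=
    mem_nhdsWithin_of_mem_nhds (gt_mem_nhds (by positivity))
  filter_upwards [hsmall, self_mem_nhdsWithin] with t ht (ht0 : 0 < t)
  obtain ⟨h1, h2, h3⟩ : t < 1 ∧ t < r / 2 ∧ t < 1 / (9 * (C + 1)) := by simpa using ht
  rw [lt_div_iff₀ (by positivity)] at h3
  have hq : ξ - (t : ℂ) • ν - ξ = -((t : ℂ) • ν) := by abel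
  have hqn : ‖ξ - (t : ℂ) • ν - ξ‖ = t := by
    rw [hq, norm_neg, norm_smul, hν.1, mul_one, Complex.norm_real, Real.norm_of_nonneg ht0.le]
  have hin : inner ℂ ν (ξ - (t : ℂ) • ν - ξ) = -(t : ℂ) := by
    rw [hq, inner_neg_right, inner_smul_right, inner_self_eq_norm_sq_to_K, hν.1]; simp
  refine (mem_admissibleDomain_of_ball hD hξ hν.1 (B := 1) (S := 1) ht0 (fun y hy => ?_) ?_ ?_ ?_
    (by norm_num) (by norm_num) (by norm_num)).1
  · rw [mem_ball, dist_eq_norm] at hy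
    set q := ξ - (t : ℂ) • ν
    have hyξ : ‖y - ξ‖ ≤ 3 / 2 * t := by
      have := norm_add_le (y - q) (q - ξ)
      rw [sub_add_sub_cancel] at this
      linarith
    refine hpar y (by rw [mem_ball, dist_eq_norm]; linarith) ?_
    have e : (inner ℂ ν (y - ξ)).re = (inner ℂ ν (y - q)).re - t := by
      rw [show y - ξ = (y - q) + (q - ξ) by abel, inner_add_right, hin,
        Complex.add_re, Complex.neg_re, Complex.ofReal_re]
      ring
    have h4 : (inner ℂ ν (y - q)).re ≤ ‖y - q‖ :=
      (Complex.re_le_norm _).trans (norm_inner_le_of_norm_eq_one hν.1 _)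
    have h5 : C * ‖y - ξ‖ ^ 2 ≤ C * (3 / 2 * t) ^ 2 := by gcongr
    rw [e]
    nlinarith
  · rw [hin]; simp; linarith
  · rw [hin, norm_neg, Complex.norm_real, Real.norm_of_nonneg ht0.le, one_mul]
  · rw [hqn]; nlinarith

lemma tendsto_coe_infty_iff {X : Type*} {l : Filter X} {f : X → ℂ} :
    Tendsto (fun x => (f x : OnePoint ℂ)) l (𝓝 OnePoint.infty) ↔
      Tendsto (fun x => ‖f x‖) l atTop := by
  rw [tendsto_norm_atTop_iff_cobounded, Metric.cobounded_eq_cocompact,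
    ← coclosedCompact_eq_cocompact, ← OnePoint.comap_coe_nhds_infty, tendsto_comap_iff]
  rfl

/-- The spherical derivative of `1/(f - c)` is `|df| / (1 + |f - c|²)`, and `1 + |f|²` is at most `2
+ 2|c|²` times `1 + |f - c|²`. -/
lemma HasDerivativeGrowth.inv_sub {f : EuclideanSpace ℂ (Fin n) → ℂ} {c : ℂ} (hD : IsOpen D)
    (hf : HasDerivativeGrowth D f ξ ν)
    (hhol : ∀ α : ℝ, 0 < α → DifferentiableOn ℂ f (admissibleDomain D ξ ν α))
    (hc : ∀ α : ℝ, 0 < α → ∀ z ∈ admissibleDomain D ξ ν α, f z ≠ c) :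
    HasDerivativeGrowth D (fun z => (f z - c)⁻¹) ξ ν := by
  intro β hβ
  obtain ⟨K, hK0, hK⟩ := hf β hβ
  refine ⟨K * (2 + 2 * ‖c‖ ^ 2), by positivity, ?_⟩
  filter_upwards [hK, self_mem_nhdsWithin] with z hz hzA s w hw
  have hne : f z - c ≠ 0 := sub_ne_zero.2 (hc β hβ z hzA)
  have hfz : DifferentiableAt ℂ f z :=
    (hhol β hβ).differentiableAt ((isOpen_admissibleDomain hD β).mem_nhds hzA)
  have hder : HasFDerivAt (fun z => (f z - c)⁻¹) (-((f z - c) ^ 2)⁻¹ • fderiv ℂ f z) z :=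
    (hasDerivAt_inv hne).comp_hasFDerivAt z (hfz.hasFDerivAt.sub_const c)
  have hpos : 0 < ‖f z - c‖ := norm_pos_iff.2 hne
  have e : ‖fderiv ℂ (fun z => (f z - c)⁻¹) z (s • ν + w)‖
      = (‖f z - c‖ ^ 2)⁻¹ * ‖fderiv ℂ f z (s • ν + w)‖ := by
    rw [hder.fderiv]
    change ‖-((f z - c) ^ 2)⁻¹ * fderiv ℂ f z (s • ν + w)‖ = _
    rw [norm_mul, norm_neg, norm_inv, norm_pow]
  have hcmp : 1 + ‖f z‖ ^ 2 ≤ (2 + 2 * ‖c‖ ^ 2) * (1 + ‖f z - c‖ ^ 2) := by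
    have h1 : ‖f z‖ ≤ ‖f z - c‖ + ‖c‖ := norm_le_norm_sub_add _ _
    have h2 : ‖f z‖ ^ 2 ≤ (‖f z - c‖ + ‖c‖) ^ 2 := by gcongr
    nlinarith [sq_nonneg (‖f z - c‖ - ‖c‖), sq_nonneg (‖f z - c‖ * ‖c‖)]
  set X := ‖s‖ / boundaryDist D ξ ν z + ‖w‖ / √(boundaryDist D ξ ν z)
  have hX : 0 ≤ X := by
    have := (boundaryDist_pos hβ hzA).le
    positivity
  rw [e]
  calc (‖f z - c‖ ^ 2)⁻¹ * ‖fderiv ℂ f z (s • ν + w)‖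
      ≤ (‖f z - c‖ ^ 2)⁻¹ * (K * X * ((2 + 2 * ‖c‖ ^ 2) * (1 + ‖f z - c‖ ^ 2))) := by
        have := hz s w hw
        gcongr
        refine this.trans ?_
        gcongr
    _ = K * (2 + 2 * ‖c‖ ^ 2) * X * (1 + ‖(f z - c)⁻¹‖ ^ 2) := by
        rw [norm_inv]
        field_simp
        ring

end AdmissibleLimit

theorem theorem4 {n : ℕ} (hn : 1 < n)
    (D : Set (EuclideanSpace ℂ (Fin n))) (hD : AdmissibleLimit.IsC2Domain D)
    (ξ : EuclideanSpace ℂ (Fin n)) (hξ : ξ ∈ frontier D)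
    (ν : EuclideanSpace ℂ (Fin n)) (hν : AdmissibleLimit.IsOutwardUnitNormal D ξ ν)
    (f : EuclideanSpace ℂ (Fin n) → ℂ) (L : OnePoint ℂ)
    (hlim : AdmissibleLimit.HasNormalLimit f ξ ν L)
    (hhol : ∀ α : ℝ, 0 < α →
      DifferentiableOn ℂ f (AdmissibleLimit.admissibleDomain D ξ ν α))
    (hvalue : ∀ α : ℝ, 0 < α →
      ∀ z ∈ AdmissibleLimit.admissibleDomain D ξ ν α, (f z : OnePoint ℂ) ≠ L)
    (hgrowth : ∀ α : ℝ, 0 < α → ∃ K : ℝ,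
      ∀ᶠ z in 𝓝[AdmissibleLimit.admissibleDomain D ξ ν α] ξ,
        AdmissibleLimit.SphericalDerivBound D f z
          (K / AdmissibleLimit.boundaryDist D ξ ν z)
          (K / Real.sqrt (AdmissibleLimit.boundaryDist D ξ ν z))) :
    AdmissibleLimit.HasAdmissibleLimit D f ξ ν L := by
  open AdmissibleLimit in
  have hDo := hD.isOpen
  have hgr : HasDerivativeGrowth D f ξ ν := fun β hβ =>
    exists_derivative_bound hξ hν hβ (hgrowth β hβ)
  intro α hα
  induction L using OnePoint.rec with
  | infty =>
    exact tendsto_coe_infty_iff.2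
      (tendsto_norm_atTop_of_normal hDo hξ hν hhol hgr (tendsto_coe_infty_iff.1 hlim) hα)
  | coe c =>
    have hc : ∀ α : ℝ, 0 < α → ∀ z ∈ admissibleDomain D ξ ν α, f z ≠ c :=
      fun α hα z hz h => hvalue α hα z hz (by rw [h])
    have hlim' : Tendsto (fun t : ℝ => f (ξ - (t : ℂ) • ν)) (𝓝[>] 0) (𝓝 c) :=
      OnePoint.isOpenEmbedding_coe.isInducing.tendsto_nhds_iff.2 hlim
    have hnormal : Tendsto (fun t : ℝ => ‖(f (ξ - (t : ℂ) • ν) - c)⁻¹‖) (𝓝[>] 0) atTop := by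
      refine tendsto_norm_cobounded_atTop.comp (tendsto_inv₀_nhdsNE_zero.comp ?_)
      refine tendsto_nhdsWithin_iff.2 ⟨by simpa using hlim'.sub_const c, ?_⟩
      filter_upwards [eventually_normal_mem_admissibleDomain hDo hξ hν] with t ht
      exact sub_ne_zero.2 (hc 4 (by norm_num) _ ht)
    have h := tendsto_norm_atTop_of_normal hDo hξ hν (h := fun z => (f z - c)⁻¹)
      (fun α hα => ((hhol α hα).sub_const c).inv fun z hz => sub_ne_zero.2 (hc α hα z hz))
      (hgr.inv_sub hDo hhol hc) hnormal hα
    have h2 := tendsto_inv₀_cobounded.comp (tendsto_norm_atTop_iff_cobounded.1 h)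
    refine OnePoint.isOpenEmbedding_coe.isInducing.tendsto_nhds_iff.1 ?_
    have h3 := h2.add_const c
    simpa [Function.comp_def] using h3
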